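/- Let $n,m\ge 1$ be integers, let $0<\alpha<nm$ and $0<p\le 1$. For measurable $\vec f=(f_1,\dots,f_m)$, $f_i:\mathbb R^n\to\mathbb C$, let $$\mathcal I_\alpha\vec f(x)=\int_{(\mathbb R^n)^m}\frac{f_1(y_1)\cdots f_m(y_m)}{(|x-y_1|+\dots+|x-y_m|)^{mn-\alpha}}\,d\vec y,\qquad \mathcal M_\alpha\vec f(x)=\sup_{Q\ni x}|Q|^{\alpha/n}\prod_{i=1}^m\frac1{|Q|}\int_Q|f_i|,$$ and for a weight $u$ (a measurable function $u:\mathbb R^n\to[0,\infty]$) let $Mu(x)=\sup_{Q\ni x}\frac1{|Q|}\int_Q u$ be its Hardy–Littlewood maximal function; the suprema are over all cubes $Q$ containing $x$ with sides parallel to the coordinate axes. Then there is a finite constant $C$, depending only on $n,m,\alpha,p$, such that for all such $\vec f$ and every weight $u$ $$\int_{\mathbb R^n}|\mathcal I_\alpha\vec f(x)|^p\,u(x)\,dx\le C\int_{\mathbb R^n}\big(\mathcal M_\alpha\vec f(x)\big)^p\,Mu(x)\,dx .$$ Here both sides may be $+\infty$ (with $0\cdot\infty=0$); if the right-hand side is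 finite, then the integral defining $\mathcal I_\alpha\vec f(x)$ converges absolutely for almost every $x$ with $u(x)\neq0$. (At points where that integral does not converge absolutely, $\mathcal I_\alpha\vec f(x)$ is given the value $0$.) -/

import Mathlib

open MeasureTheory
open scoped ENNReal NNReal

noncomputable section

/-- Nondegenerate cubes of `ℝⁿ` with sides parallel to the coordinate axes. -/
def IsCube {n : ℕ} (Q : Set (EuclideanSpace ℝ (Fin n))) : Prop :=
  ∃ (a : EuclideanSpace ℝ (Fin n)) (l : ℝ), 0 < l ∧ Q = {y | ∀ j, y j ∈ Set.Icc (a j) (a j + l)}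

/-- The integrand of the multilinear fractional integral at the point `x`:
`f₁(y₁) ⋯ f_m(y_m) / (|x - y₁| + ⋯ + |x - y_m|) ^ (mn - α)`. -/
def fracIntegrand {n m : ℕ} (α : ℝ) (f : Fin m → EuclideanSpace ℝ (Fin n) → ℂ)
    (x : EuclideanSpace ℝ (Fin n)) (y : Fin m → EuclideanSpace ℝ (Fin n)) : ℂ :=
  (∏ i, f i (y i)) / (((∑ i, ‖x - y i‖) ^ ((m : ℝ) * n - α) : ℝ) : ℂ)

/-- The multilinear fractional integral, an integral over `(ℝⁿ)^m`. -/
def fracIntegral {n m : ℕ} (α : ℝ) (f : Fin m → EuclideanSpace ℝ (Fin n) → ℂ)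
    (x : EuclideanSpace ℝ (Fin n)) : ℂ :=
  ∫ y : Fin m → EuclideanSpace ℝ (Fin n), fracIntegrand α f x y

/-- The multilinear fractional maximal operator: the supremum over all cubes `Q` containing `x`
of `|Q| ^ (α / n)` times the product of the averages of the `|f i|` over `Q`. -/
def fracMaximal {n m : ℕ} (α : ℝ) (f : Fin m → EuclideanSpace ℝ (Fin n) → ℂ)
    (x : EuclideanSpace ℝ (Fin n)) : ℝ≥0∞ :=
  ⨆ (Q : Set (EuclideanSpace ℝ (Fin n))) (_ : IsCube Q) (_ : x ∈ Q),
    volume Q ^ (α / (n : ℝ)) * ∏ i, ((volume Q)⁻¹ * ∫⁻ y in Q, ‖f i y‖ₑ)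

/-- The (uncentred) Hardy–Littlewood maximal function of a weight. -/
def hlMaximal {n : ℕ} (u : EuclideanSpace ℝ (Fin n) → ℝ≥0∞)
    (x : EuclideanSpace ℝ (Fin n)) : ℝ≥0∞ :=
  ⨆ (Q : Set (EuclideanSpace ℝ (Fin n))) (_ : IsCube Q) (_ : x ∈ Q), (volume Q)⁻¹ * ∫⁻ y in Q, u y

end

/-! Splitting according to the size of |x - y_1| + ... + |x - y_m| bounds the fractional integral by
a constant times the sum over j of S_j(x) = 4^(j(α - mn)) ∏ ∫_{B(x, 4^j)} |f_i|. Since p ≤ 1, the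
p-th power of the sum is at most the sum of the p-th powers, so it suffices to bound ∑_j ∫ S_j^p u.

Each S_j is at most a constant times the maximal function, but there are infinitely many scales. The
way out is to call y good at scale j if the product of averages over every smaller ball about y is
at most a constant times the one at scale j. At a fixed y, the terms S_j(y) over its good scales
decay like 4^(-α k) below the largest one considered, so the sum of their p-th powers is controlled
by (sup_j S_j(y))^p (`tsum_indicator_goodSet_le`).

It remains to discard the bad scales. The weak type (1,1) estimate shows that points good at scale j
+ 1 fill at least half of B(x, 4^j) (`volume_closedBall_le_two_mul_goodSet`), and S_j(x) is at most
a constant times S_{j+1}(y) for every y in that ball. Averaging over these y and applying Fubini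
moves the average onto u, where Mu(y) bounds it (`lintegral_ballProd_mul_le`). Summing over j gives
`exists_tsum_lintegral_scaledProd_le`, which holds for all p > 0. -/

/-! ### Product integrals, subadditivity of powers, cubes -/

/-- Tonelli's theorem for products of functions of one variable. -/
theorem lintegral_pi_prod {X : Type*} [MeasurableSpace X] (μ : Measure X) [SigmaFinite μ]
    {m : ℕ} (h : Fin m → X → ℝ≥0∞) (hh : ∀ i, Measurable (h i)) :
    ∫⁻ y, ∏ i, h i (y i) ∂(Measure.pi fun _ : Fin m => μ) = ∏ i, ∫⁻ x, h i x ∂μ := by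
  induction m with
  | zero => simp
  | succ m ih =>
    have hmp := (measurePreserving_piFinSuccAbove (fun _ : Fin (m + 1) => μ) 0).symm
    rw [← hmp.lintegral_comp (f := fun y => ∏ i, h i (y i))
      (Finset.measurable_prod _ fun i _ => (hh i).comp (measurable_pi_apply i))]
    have key : ∀ z : X × (Fin m → X),
        ∏ i, h i ((MeasurableEquiv.piFinSuccAbove (fun _ : Fin (m + 1) => X) 0).symm z i)
          = h 0 z.1 * ∏ i : Fin m, h i.succ (z.2 i) := by
      intro z
      rw [Fin.prod_univ_succ]
      simp [MeasurableEquiv.piFinSuccAbove]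
    simp_rw [key]
    rw [lintegral_prod_mul (f := h 0) (g := fun w : Fin m → X => ∏ i : Fin m, h i.succ (w i))
      (hh 0).aemeasurable (Finset.measurable_prod _ fun i _ =>
        (hh i.succ).comp (measurable_pi_apply i)).aemeasurable,
      ih (fun i => h i.succ) fun i => hh i.succ, Fin.prod_univ_succ]

theorem ENNReal.rpow_finset_sum_le {ι : Type*} {p : ℝ} (hp : 0 < p) (hp1 : p ≤ 1) (s : Finset ι)
    (c : ι → ℝ≥0∞) : (∑ i ∈ s, c i) ^ p ≤ ∑ i ∈ s, c i ^ p := by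
  classical
  induction s using Finset.induction_on with
  | empty => simp [hp]
  | insert a s ha ih =>
    rw [Finset.sum_insert ha, Finset.sum_insert ha]
    exact (ENNReal.rpow_add_le_add_rpow _ _ hp.le hp1).trans (by gcongr)

theorem ENNReal.rpow_tsum_le {ι : Type*} {p : ℝ} (hp : 0 < p) (hp1 : p ≤ 1) (c : ι → ℝ≥0∞) :
    (∑' i, c i) ^ p ≤ ∑' i, c i ^ p := by
  rw [← ENNReal.le_rpow_inv_iff hp, ENNReal.tsum_eq_iSup_sum]
  refine iSup_le fun s => ?_
  rw [ENNReal.le_rpow_inv_iff hp]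
  exact (ENNReal.rpow_finset_sum_le hp hp1 s c).trans (ENNReal.sum_le_tsum s)

/-- Lebesgue measure of a cube. -/
theorem volume_cube {n : ℕ} (a : EuclideanSpace ℝ (Fin n)) (l : ℝ) :
    volume {y : EuclideanSpace ℝ (Fin n) | ∀ j, y j ∈ Set.Icc (a j) (a j + l)}
      = ENNReal.ofReal l ^ n := by
  have h := (PiLp.volume_preserving_ofLp (Fin n)).measure_preimage
    (s := Set.Icc (fun j => a j) (fun j => a j + l)) measurableSet_Icc.nullMeasurableSet
  rw [Real.volume_Icc_pi] at h
  have e : (WithLp.ofLp ⁻¹' Set.Icc (fun j => a j) (fun j => a j + l) :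
      Set (EuclideanSpace ℝ (Fin n))) = {y | ∀ j, y j ∈ Set.Icc (a j) (a j + l)} := by
    ext y
    simp [Set.mem_Icc, Pi.le_def, forall_and]
  rw [← e, h]
  simp

/-- Every closed ball is contained in a concentric cube. -/
theorem exists_cube_closedBall_subset {n : ℕ} (x : EuclideanSpace ℝ (Fin n)) {r : ℝ} (hr : 0 < r) :
    ∃ Q, IsCube Q ∧ x ∈ Q ∧ Metric.closedBall x r ⊆ Q ∧
      volume Q = ENNReal.ofReal (2 * r) ^ n := by
  have hsub : Metric.closedBall x r ⊆ {y : EuclideanSpace ℝ (Fin n) |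
      ∀ j, y j ∈ Set.Icc ((WithLp.toLp 2 fun i => x i - r : EuclideanSpace ℝ (Fin n)) j)
        ((WithLp.toLp 2 fun i => x i - r : EuclideanSpace ℝ (Fin n)) j + 2 * r)} := by
    intro y hy j
    have h1 : |y j - x j| ≤ r := by
      have := PiLp.norm_apply_le (y - x) j
      rw [Metric.mem_closedBall, dist_eq_norm] at hy
      simpa [Real.norm_eq_abs] using this.trans hy
    rw [abs_le] at h1
    simp only [Set.mem_Icc]
    constructor <;> linarith
  exact ⟨_, ⟨WithLp.toLp 2 fun i => x i - r, 2 * r, by positivity, rfl⟩,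
    hsub (Metric.mem_closedBall_self hr.le), hsub, volume_cube _ _⟩

/-! ### Weak type estimate by Vitali covering -/

/-- A weak type estimate for averages over balls of radius at most `R` centred in a ball of
radius `R`. -/
theorem volume_large_averages_mul_le {n : ℕ} (g : EuclideanSpace ℝ (Fin n) → ℝ≥0∞)
    (x : EuclideanSpace ℝ (Fin n)) (R : ℝ) (t : ℝ≥0∞)
    (h0 : ∫⁻ y in Metric.closedBall x (2 * R), g y ≠ 0)
    (htop : ∫⁻ y in Metric.closedBall x (2 * R), g y ≠ ∞) :
    volume {y ∈ Metric.closedBall x R | ∃ r : ℝ, 0 < r ∧ r ≤ R ∧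
        (∫⁻ z in Metric.closedBall x (2 * R), g z) * (ENNReal.ofReal r ^ n * t)
          ≤ ∫⁻ z in Metric.closedBall y r, g z} * t
      ≤ 5 ^ n * volume (Metric.ball (0 : EuclideanSpace ℝ (Fin n)) 1) := by
  set D := ∫⁻ y in Metric.closedBall x (2 * R), g y with hD
  set ω := volume (Metric.ball (0 : EuclideanSpace ℝ (Fin n)) 1) with hω
  set S := {y ∈ Metric.closedBall x R | ∃ r : ℝ, 0 < r ∧ r ≤ R ∧
        D * (ENNReal.ofReal r ^ n * t) ≤ ∫⁻ z in Metric.closedBall y r, g z} with hS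
  have hex : ∀ y : EuclideanSpace ℝ (Fin n), ∃ r : ℝ, y ∈ S → (0 < r ∧ r ≤ R ∧
        D * (ENNReal.ofReal r ^ n * t) ≤ ∫⁻ z in Metric.closedBall y r, g z) := by
    intro y
    by_cases hy : y ∈ S
    · obtain ⟨r, hr⟩ := hy.2
      exact ⟨r, fun _ => hr⟩
    · exact ⟨0, fun h => absurd h hy⟩
  choose r hr using hex
  -- The radii are bounded by `R`, so Vitali's lemma gives disjoint balls whose fivefold
  -- enlargements cover `S`; this is the source of `5 ^ n`.
  obtain ⟨v, hvS, hdisj, hcov⟩ := Vitali.exists_disjoint_subfamily_covering_enlargement_closedBall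
    S id r R (fun a ha => (hr a ha).2.1) 5 (by norm_num)
  simp only [id] at hdisj hcov
  have hvc : v.Countable := hdisj.countable_of_nonempty_interior fun a ha => by
    refine ⟨a, ?_⟩
    exact Metric.ball_subset_interior_closedBall (Metric.mem_ball_self (hr a (hvS ha)).1)
  have hSv : S ⊆ ⋃ a ∈ v, Metric.closedBall a (5 * r a) := by
    intro y hy
    obtain ⟨b, hb, hyb⟩ := hcov y hy
    exact Set.mem_biUnion hb (hyb (Metric.mem_closedBall_self (hr y hy).1.le))
  have hvol : ∀ a ∈ v, volume (Metric.closedBall a (5 * r a))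
      = 5 ^ n * ω * ENNReal.ofReal (r a) ^ n := by
    intro a ha
    have h := (hr a (hvS ha)).1
    rw [Measure.addHaar_closedBall _ _ (by positivity), finrank_euclideanSpace_fin,
      ENNReal.ofReal_pow (by positivity), ENNReal.ofReal_mul (by norm_num), mul_pow]
    simp only [ENNReal.ofReal_ofNat]
    ring
  have main : D * (volume S * t) ≤ D * (5 ^ n * ω) := by
    have : Countable v := hvc.to_subtype
    calc D * (volume S * t)
        ≤ D * ((∑' a : v, volume (Metric.closedBall (a : EuclideanSpace ℝ (Fin n)) (5 * r a))) * t) := by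
          gcongr
          exact (measure_mono hSv).trans (measure_biUnion_le _ hvc _)
      _ = ∑' a : v, 5 ^ n * ω * (D * (ENNReal.ofReal (r a) ^ n * t)) := by
          rw [← ENNReal.tsum_mul_right, ← ENNReal.tsum_mul_left]
          refine tsum_congr fun a => ?_
          rw [hvol a a.2]
          ring
      _ ≤ ∑' a : v, 5 ^ n * ω * ∫⁻ z in Metric.closedBall (a : EuclideanSpace ℝ (Fin n)) (r a), g z := by
          refine ENNReal.tsum_le_tsum fun a => ?_
          gcongr
          exact (hr a (hvS a.2)).2.2
      _ = 5 ^ n * ω * ∫⁻ z in ⋃ a ∈ v, Metric.closedBall a (r a), g z := by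
          rw [ENNReal.tsum_mul_left,
            lintegral_biUnion hvc (fun _ _ => Metric.isClosed_closedBall.measurableSet) hdisj]
      _ ≤ 5 ^ n * ω * D := by
          gcongr
          -- Centres within `R` of `x` and radii at most `R` keep the disjoint balls inside the ball
          -- of radius `2 * R`.
          refine lintegral_mono_set (Set.iUnion₂_subset fun a ha => ?_)
          refine Metric.closedBall_subset_closedBall' ?_
          have h1 := (hr a (hvS ha)).2.1
          have h2 : dist a x ≤ R := (hvS ha).1
          linarith
      _ = D * (5 ^ n * ω) := mul_comm _ _
  exact (ENNReal.mul_le_mul_iff_right h0 htop).1 main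

/-! ### Good points and their density -/

/-- The product of the integrals of the `g i` over the closed ball of radius `4 ^ s`. -/
noncomputable def ballProd {n m : ℕ} (g : Fin m → EuclideanSpace ℝ (Fin n) → ℝ≥0∞) (s : ℝ)
    (x : EuclideanSpace ℝ (Fin n)) : ℝ≥0∞ :=
  ∏ i, ∫⁻ y in Metric.closedBall x ((4 : ℝ) ^ s), g i y

/-- The points at which the products of averages over smaller balls are controlled by the one at
scale `4 ^ j`. -/
def goodSet {n m : ℕ} (g : Fin m → EuclideanSpace ℝ (Fin n) → ℝ≥0∞) (B : ℝ≥0∞) (j : ℤ) :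
    Set (EuclideanSpace ℝ (Fin n)) :=
  {y | ∀ i : ℤ, i ≤ j → ballProd g i y ≤ B * ((4 : ℝ≥0∞) ^ (((i : ℝ) - j) * (m * n)) * ballProd g j y)}

theorem ofReal_four_rpow (s : ℝ) : ENNReal.ofReal ((4 : ℝ) ^ s) = (4 : ℝ≥0∞) ^ s := by
  rw [← ENNReal.ofReal_rpow_of_pos (by norm_num)]
  simp

theorem four_rpow_ne_zero (s : ℝ) : (4 : ℝ≥0∞) ^ s ≠ 0 := by
  simp [ENNReal.rpow_eq_zero_iff]

theorem four_rpow_ne_top (s : ℝ) : (4 : ℝ≥0∞) ^ s ≠ ∞ := by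
  simp [ENNReal.rpow_eq_top_iff]

theorem four_rpow_add (s t : ℝ) : (4 : ℝ≥0∞) ^ (s + t) = 4 ^ s * 4 ^ t :=
  ENNReal.rpow_add _ _ (by norm_num) (by norm_num)

theorem measurable_setLIntegral_closedBall {n : ℕ} {g : EuclideanSpace ℝ (Fin n) → ℝ≥0∞}
    (hg : Measurable g) (r : ℝ) : Measurable fun x => ∫⁻ y in Metric.closedBall x r, g y := by
  have h : ∀ x, ∫⁻ y in Metric.closedBall x r, g y
      = ∫⁻ y, {q : EuclideanSpace ℝ (Fin n) × EuclideanSpace ℝ (Fin n) |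
          dist q.2 q.1 ≤ r}.indicator (fun q => g q.2) (x, y) := by
    intro x
    rw [← lintegral_indicator Metric.isClosed_closedBall.measurableSet]
    rfl
  simp_rw [h]
  exact Measurable.lintegral_prod_right' ((hg.comp measurable_snd).indicator
    (measurableSet_le (measurable_snd.dist measurable_fst) measurable_const))

theorem measurable_ballProd {n m : ℕ} {g : Fin m → EuclideanSpace ℝ (Fin n) → ℝ≥0∞}
    (hg : ∀ i, Measurable (g i)) (s : ℝ) : Measurable (ballProd g s) :=
  Finset.measurable_prod _ fun i _ => measurable_setLIntegral_closedBall (hg i) _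

theorem measurableSet_goodSet {n m : ℕ} {g : Fin m → EuclideanSpace ℝ (Fin n) → ℝ≥0∞}
    (hg : ∀ i, Measurable (g i)) (B : ℝ≥0∞) (j : ℤ) : MeasurableSet (goodSet g B j) := by
  have : goodSet g B j = ⋂ (i : ℤ) (_ : i ≤ j), {y | ballProd g i y
      ≤ B * ((4 : ℝ≥0∞) ^ (((i : ℝ) - j) * (m * n)) * ballProd g j y)} := by
    ext y
    simp [goodSet]
  rw [this]
  exact MeasurableSet.iInter fun i => MeasurableSet.iInter fun _ =>
    measurableSet_le (measurable_ballProd hg _)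
      (((measurable_ballProd hg _).const_mul _).const_mul _)

theorem four_rpow_intCast_add_one (j : ℤ) : (4 : ℝ) ^ (((j + 1 : ℤ)) : ℝ) = 4 * 4 ^ (j : ℝ) := by
  push_cast
  rw [Real.rpow_add (by norm_num), Real.rpow_one, mul_comm]

theorem closedBall_two_mul_subset {n : ℕ} {x y : EuclideanSpace ℝ (Fin n)} {j : ℤ}
    (hy : y ∈ Metric.closedBall x ((4 : ℝ) ^ (j : ℝ))) :
    Metric.closedBall x (2 * (4 : ℝ) ^ (j : ℝ))
      ⊆ Metric.closedBall y ((4 : ℝ) ^ (((j + 1 : ℤ)) : ℝ)) := by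
  refine Metric.closedBall_subset_closedBall' ?_
  rw [four_rpow_intCast_add_one]
  have h1 : dist x y ≤ (4 : ℝ) ^ (j : ℝ) := by
    rw [dist_comm]
    exact hy
  have h2 : (0 : ℝ) < (4 : ℝ) ^ (j : ℝ) := by positivity
  linarith

theorem prod_two_mul_le_ballProd {n m : ℕ} (g : Fin m → EuclideanSpace ℝ (Fin n) → ℝ≥0∞)
    {x y : EuclideanSpace ℝ (Fin n)} {j : ℤ}
    (hy : y ∈ Metric.closedBall x ((4 : ℝ) ^ (j : ℝ))) :
    ∏ i, ∫⁻ z in Metric.closedBall x (2 * (4 : ℝ) ^ (j : ℝ)), g i z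
      ≤ ballProd g ((j + 1 : ℤ) : ℝ) y :=
  Finset.prod_le_prod' fun _ _ => lintegral_mono_set (closedBall_two_mul_subset hy)

theorem ballProd_le_prod_two_mul {n m : ℕ} (g : Fin m → EuclideanSpace ℝ (Fin n) → ℝ≥0∞)
    (x : EuclideanSpace ℝ (Fin n)) (j : ℤ) :
    ballProd g j x ≤ ∏ i, ∫⁻ z in Metric.closedBall x (2 * (4 : ℝ) ^ (j : ℝ)), g i z :=
  Finset.prod_le_prod' fun _ _ => lintegral_mono_set <| Metric.closedBall_subset_closedBall <| by
    have h2 : (0 : ℝ) < (4 : ℝ) ^ (j : ℝ) := by positivity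
    linarith

theorem volume_closedBall_four_rpow {n : ℕ} (x : EuclideanSpace ℝ (Fin n)) (s : ℝ) :
    volume (Metric.closedBall x ((4 : ℝ) ^ s))
      = ((4 : ℝ≥0∞) ^ s) ^ n * volume (Metric.ball (0 : EuclideanSpace ℝ (Fin n)) 1) := by
  rw [Measure.addHaar_closedBall _ _ (by positivity), finrank_euclideanSpace_fin,
    ENNReal.ofReal_pow (by positivity), ofReal_four_rpow]

/-- The constant in the definition of good sets for which they fill at least half of each ball. -/
noncomputable def goodConst (n m : ℕ) : ℝ≥0∞ := (2 * (m + 1) * 20 ^ n) ^ m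

theorem one_le_goodBase (n m : ℕ) : (1 : ℝ≥0∞) ≤ 2 * (m + 1) * 20 ^ n := by
  have : (1 : ℕ) ≤ 2 * (m + 1) * 20 ^ n := Nat.one_le_iff_ne_zero.2 (by positivity)
  exact_mod_cast this

theorem one_le_goodConst (n m : ℕ) : 1 ≤ goodConst n m := one_le_pow₀ (one_le_goodBase n m)

theorem goodConst_ne_top (n m : ℕ) : goodConst n m ≠ ∞ := by
  unfold goodConst
  finiteness

/-- If no single average is large at any radius up to `4 ^ j`, multiplying the `m` bounds shows that
`y` is good. Thus badness is always caused by one factor, to which the linear weak type estimate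
applies. -/
theorem mem_goodSet_or_exists {n m : ℕ} (g : Fin m → EuclideanSpace ℝ (Fin n) → ℝ≥0∞)
    (x : EuclideanSpace ℝ (Fin n)) (j : ℤ) {y : EuclideanSpace ℝ (Fin n)}
    (hy : y ∈ Metric.closedBall x ((4 : ℝ) ^ (j : ℝ))) (hb : y ∉ goodSet g (goodConst n m) (j + 1)) :
    ∃ k, ∃ r : ℝ, 0 < r ∧ r ≤ (4 : ℝ) ^ (j : ℝ) ∧
        (∫⁻ z in Metric.closedBall x (2 * (4 : ℝ) ^ (j : ℝ)), g k z) * (ENNReal.ofReal r ^ n *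
          (2 * (m + 1) * 20 ^ n * (((4 : ℝ≥0∞) ^ ((j + 1 : ℤ) : ℝ)) ^ n)⁻¹))
          ≤ ∫⁻ z in Metric.closedBall y r, g k z := by
  by_contra! hcon
  refine hb fun i hi => ?_
  rcases eq_or_lt_of_le hi with rfl | hlt
  -- The top scale `j + 1` is compared with itself, which only needs a constant at least 1.
  · simp only [sub_self, zero_mul, ENNReal.rpow_zero, one_mul]
    exact le_mul_of_one_le_left' (one_le_goodConst n m)
  have hij : i ≤ j := by omega
  have hk := fun k => (hcon k ((4 : ℝ) ^ (i : ℝ)) (by positivity)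
    (Real.rpow_le_rpow_of_exponent_le (by norm_num) (by exact_mod_cast hij))).le
  calc ballProd g i y ≤ ∏ k : Fin m, _ := Finset.prod_le_prod' fun k _ => hk k
    _ = goodConst n m * ((4 : ℝ≥0∞) ^ (((i : ℝ) - (j + 1 : ℤ)) * (m * n)) *
        ∏ k, ∫⁻ z in Metric.closedBall x (2 * (4 : ℝ) ^ (j : ℝ)), g k z) := by
      rw [Finset.prod_mul_distrib, Finset.prod_const, Finset.card_univ, Fintype.card_fin,
        ofReal_four_rpow, goodConst]
      have e : (4 : ℝ≥0∞) ^ (((i : ℝ) - (j + 1 : ℤ)) * (m * n))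
          = (((4 : ℝ≥0∞) ^ (i : ℝ)) ^ n * (((4 : ℝ≥0∞) ^ ((j + 1 : ℤ) : ℝ)) ^ n)⁻¹) ^ m := by
        rw [← ENNReal.rpow_mul_natCast, ← ENNReal.rpow_mul_natCast, ← ENNReal.rpow_neg,
          ← four_rpow_add, ← ENNReal.rpow_mul_natCast]
        congr 1
        ring
      rw [e]
      generalize (2 * (m + 1) * 20 ^ n : ℝ≥0∞) = b
      ring
    _ ≤ _ := by
      gcongr
      exact prod_two_mul_le_ballProd g hy

/-- The bad part of the ball is covered by `m` sets, one for each factor, each of measure at most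
1/(2(m + 1)) of the ball by the weak type estimate. Nonvanishing of the product allows division by
each integral. -/
theorem volume_closedBall_le_two_mul_goodSet {n m : ℕ}
    {g : Fin m → EuclideanSpace ℝ (Fin n) → ℝ≥0∞} (hg : ∀ i, Measurable (g i))
    (x : EuclideanSpace ℝ (Fin n)) (j : ℤ) (h : ballProd g j x ≠ 0) :
    volume (Metric.closedBall x ((4 : ℝ) ^ (j : ℝ)))
      ≤ 2 * volume (Metric.closedBall x ((4 : ℝ) ^ (j : ℝ)) ∩ goodSet g (goodConst n m) (j + 1)) := by
  set R := (4 : ℝ) ^ (j : ℝ) with hR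
  set K := Metric.closedBall x R with hK
  set G := goodSet g (goodConst n m) (j + 1) with hG
  set ω := volume (Metric.ball (0 : EuclideanSpace ℝ (Fin n)) 1) with hω
  have hprod : ∏ i, ∫⁻ z in Metric.closedBall x (2 * R), g i z ≠ 0 :=
    (h.bot_lt.trans_le (ballProd_le_prod_two_mul g x j)).ne'
  have hD0 : ∀ i, ∫⁻ z in Metric.closedBall x (2 * R), g i z ≠ 0 := fun i =>
    Finset.prod_ne_zero_iff.1 hprod i (Finset.mem_univ i)
  by_cases hDtop : ∃ i, ∫⁻ z in Metric.closedBall x (2 * R), g i z = ∞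
  · have htop : ∏ i, ∫⁻ z in Metric.closedBall x (2 * R), g i z = ∞ := by
      obtain ⟨i, hi⟩ := hDtop
      rw [← Finset.mul_prod_erase _ _ (Finset.mem_univ i), hi]
      exact ENNReal.top_mul (Finset.prod_ne_zero_iff.2 fun k _ => hD0 k)
    -- If some integral is infinite, the product at scale `j + 1` is infinite throughout the ball,
    -- and every point of it is good.
    have hsub : K ∩ G = K := by
      refine Set.inter_eq_left.2 fun y hy i _ => ?_
      have hy' := prod_two_mul_le_ballProd g hy
      rw [htop, top_le_iff] at hy'
      rw [hy', ENNReal.mul_top (four_rpow_ne_zero _),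
        ENNReal.mul_top (zero_lt_one.trans_le (one_le_goodConst n m)).ne']
      exact le_top
    rw [hsub]
    exact le_mul_of_one_le_left' (by norm_num)
  push Not at hDtop
  set c := ((4 : ℝ≥0∞) ^ ((j + 1 : ℤ) : ℝ)) ^ n with hc
  have hc0 : c ≠ 0 := pow_ne_zero _ (four_rpow_ne_zero _)
  have hct : c ≠ ∞ := ENNReal.pow_ne_top (four_rpow_ne_top _)
  have hV : volume K = ((4 : ℝ≥0∞) ^ (j : ℝ)) ^ n * ω := volume_closedBall_four_rpow x j
  have hVt : volume K ≠ ∞ := measure_closedBall_lt_top.ne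
  set T : Fin m → Set (EuclideanSpace ℝ (Fin n)) := fun k => {y ∈ K | ∃ r : ℝ, 0 < r ∧ r ≤ R ∧
    (∫⁻ z in Metric.closedBall x (2 * R), g k z) *
      (ENNReal.ofReal r ^ n * (2 * (m + 1) * 20 ^ n * c⁻¹)) ≤ ∫⁻ z in Metric.closedBall y r, g k z}
    with hT
  -- Here 20 = 5 · 4: the 5 pays for the Vitali enlargement, the 4 for normalising averages at scale
  -- `4 ^ (j + 1)` instead of `4 ^ j`.
  have hTk : ∀ k, volume (T k) * (2 * (m + 1)) ≤ volume K := by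
    intro k
    have h1 := volume_large_averages_mul_le (g k) x R (2 * (m + 1) * 20 ^ n * c⁻¹) (hD0 k) (hDtop k)
    have h2 : (20 : ℝ≥0∞) ^ n * (volume (T k) * (2 * (m + 1))) ≤ 20 ^ n * volume K := by
      calc (20 : ℝ≥0∞) ^ n * (volume (T k) * (2 * (m + 1)))
          = volume (T k) * (2 * (m + 1) * 20 ^ n * c⁻¹) * c := by
            rw [mul_assoc (volume (T k)), mul_assoc _ c⁻¹ c, ENNReal.inv_mul_cancel hc0 hct]
            ring
        _ ≤ 5 ^ n * ω * c := by
            gcongr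
        _ = 20 ^ n * volume K := by
            rw [hV, hc, Int.cast_add, Int.cast_one, four_rpow_add, ENNReal.rpow_one,
              show (20 : ℝ≥0∞) ^ n = 5 ^ n * 4 ^ n by rw [← mul_pow]; norm_num]
            ring
    exact (ENNReal.mul_le_mul_iff_right (by positivity) (by finiteness)).1 h2
  have hbad : K \ G ⊆ ⋃ k, T k := by
    rintro y ⟨hyK, hyG⟩
    obtain ⟨k, hk⟩ := mem_goodSet_or_exists g x j hyK hyG
    exact Set.mem_iUnion.2 ⟨k, hyK, hk⟩
  have hbadvol : 2 * volume (K \ G) ≤ volume K := by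
    have h1 : volume (K \ G) ≤ ∑ k, volume (T k) :=
      (measure_mono hbad).trans (measure_iUnion_fintype_le _ _)
    have h2 : (m + 1 : ℝ≥0∞) * (2 * volume (K \ G)) ≤ (m + 1) * volume K :=
      calc (m + 1 : ℝ≥0∞) * (2 * volume (K \ G)) ≤ (m + 1) * (2 * ∑ k, volume (T k)) := by gcongr
        _ = ∑ k, volume (T k) * (2 * (m + 1)) := by
            rw [← Finset.sum_mul]
            ring
        _ ≤ ∑ _k : Fin m, volume K := Finset.sum_le_sum fun k _ => hTk k
        _ = m * volume K := by simp
        _ ≤ (m + 1) * volume K := by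
            gcongr
            exact le_self_add
    exact (ENNReal.mul_le_mul_iff_right (by positivity) (by finiteness)).1 h2
  have hsplit : volume (K ∩ G) + volume (K \ G) = volume K :=
    measure_inter_add_sdiff K (measurableSet_goodSet hg _ _)
  have h3 : volume K + volume K ≤ 2 * volume (K ∩ G) + volume K :=
    calc volume K + volume K = 2 * volume (K ∩ G) + 2 * volume (K \ G) := by
          rw [← mul_add, hsplit, two_mul]
      _ ≤ _ := by gcongr
  exact (ENNReal.add_le_add_iff_right hVt).1 h3

/-! ### Averaging over good points and Fubini -/

/-- Comparison, after integration, of one scale with the next larger one on good points. -/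
theorem lintegral_ballProd_mul_le {n m : ℕ}
    {g : Fin m → EuclideanSpace ℝ (Fin n) → ℝ≥0∞} (hg : ∀ i, Measurable (g i))
    {u : EuclideanSpace ℝ (Fin n) → ℝ≥0∞} (hu : Measurable u) {p : ℝ} (hp : 0 < p) (j : ℤ) :
    ((4 : ℝ≥0∞) ^ (j : ℝ)) ^ n * volume (Metric.ball (0 : EuclideanSpace ℝ (Fin n)) 1) *
        ∫⁻ x, ballProd g j x ^ p * u x
      ≤ 2 * ∫⁻ y, (goodSet g (goodConst n m) (j + 1)).indicator
          (fun y => ballProd g ((j + 1 : ℤ) : ℝ) y ^ p) y *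
            ∫⁻ x in Metric.closedBall y ((4 : ℝ) ^ (j : ℝ)), u x := by
  set R := (4 : ℝ) ^ (j : ℝ) with hR
  set G := goodSet g (goodConst n m) (j + 1) with hG
  have hGm : MeasurableSet G := measurableSet_goodSet hg _ _
  set H := G.indicator (fun y => ballProd g ((j + 1 : ℤ) : ℝ) y ^ p) with hH
  have hHm : Measurable H := ((measurable_ballProd hg _).pow_const p).indicator hGm
  -- The value at `x` is averaged over the good half of the ball. For each `y` there, the ball of
  -- radius `4 ^ j` about `x` lies in that of radius `4 ^ (j + 1)` about `y`.
  have hpt : ∀ x, ((4 : ℝ≥0∞) ^ (j : ℝ)) ^ n *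
      volume (Metric.ball (0 : EuclideanSpace ℝ (Fin n)) 1) * ballProd g j x ^ p
        ≤ 2 * ∫⁻ y in Metric.closedBall x R, H y := by
    intro x
    by_cases h : ballProd g j x = 0
    · simp [h, hp]
    rw [← volume_closedBall_four_rpow x j]
    calc volume (Metric.closedBall x R) * ballProd g j x ^ p
        ≤ 2 * volume (Metric.closedBall x R ∩ G) * ballProd g j x ^ p := by
          gcongr
          exact volume_closedBall_le_two_mul_goodSet hg x j h
      _ = 2 * ∫⁻ _ in Metric.closedBall x R ∩ G, ballProd g j x ^ p := by
          rw [setLIntegral_const]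
          ring
      _ ≤ 2 * ∫⁻ y in Metric.closedBall x R ∩ G, H y := by
          gcongr 2 * ?_
          refine setLIntegral_mono' (Metric.isClosed_closedBall.measurableSet.inter hGm) ?_
          rintro y ⟨hyK, hyG⟩
          rw [hH, Set.indicator_of_mem hyG]
          gcongr
          exact (ballProd_le_prod_two_mul g x j).trans (prod_two_mul_le_ballProd g hyK)
      _ ≤ _ := by
          gcongr
          exact Set.inter_subset_left
  have hKm : Measurable fun q : EuclideanSpace ℝ (Fin n) × EuclideanSpace ℝ (Fin n) =>
      {q : EuclideanSpace ℝ (Fin n) × EuclideanSpace ℝ (Fin n) | dist q.1 q.2 ≤ R}.indicator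
        (fun q => H q.2 * u q.1) q :=
    ((hHm.comp measurable_snd).mul (hu.comp measurable_fst)).indicator
      (measurableSet_le (measurable_fst.dist measurable_snd) measurable_const)
  calc _ = ∫⁻ x, ((4 : ℝ≥0∞) ^ (j : ℝ)) ^ n *
        volume (Metric.ball (0 : EuclideanSpace ℝ (Fin n)) 1) * ballProd g j x ^ p * u x := by
        rw [← lintegral_const_mul (f := fun x => ballProd g j x ^ p * u x) _ (((measurable_ballProd hg _).pow_const p).mul hu)]
        simp_rw [mul_assoc]
    _ ≤ ∫⁻ x, (2 * ∫⁻ y in Metric.closedBall x R, H y) * u x := by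
        exact lintegral_mono fun x => mul_le_mul_left (hpt x) _
    _ = 2 * ∫⁻ x, (∫⁻ y in Metric.closedBall x R, H y) * u x := by
        rw [← lintegral_const_mul (f := fun x => (∫⁻ y in Metric.closedBall x R, H y) * u x) _
          ((measurable_setLIntegral_closedBall hHm R).mul hu)]
        simp_rw [mul_assoc]
    _ = 2 * ∫⁻ x, ∫⁻ y, {q : EuclideanSpace ℝ (Fin n) × EuclideanSpace ℝ (Fin n) |
          dist q.1 q.2 ≤ R}.indicator (fun q => H q.2 * u q.1) (x, y) := by
        congr 1
        refine lintegral_congr fun x => ?_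
        rw [← lintegral_mul_const _ hHm,
          ← lintegral_indicator Metric.isClosed_closedBall.measurableSet]
        refine lintegral_congr fun y => ?_
        simp only [Set.indicator, Metric.mem_closedBall, Set.mem_ofPred_eq, dist_comm y x]
    -- The kernel `dist x y ≤ R` is symmetric, so the exchange turns an average of `H` about `x`
    -- into an integral of `u` about `y`.
    _ = 2 * ∫⁻ y, ∫⁻ x, {q : EuclideanSpace ℝ (Fin n) × EuclideanSpace ℝ (Fin n) |
          dist q.1 q.2 ≤ R}.indicator (fun q => H q.2 * u q.1) (x, y) := by
        rw [lintegral_lintegral_swap hKm.aemeasurable]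
    _ = _ := by
        congr 1
        refine lintegral_congr fun y => ?_
        rw [← lintegral_const_mul _ hu,
          ← lintegral_indicator Metric.isClosed_closedBall.measurableSet]
        rfl

/-! ### Summation over scales and comparison with the maximal functions -/

/-- The contribution of the scale `4 ^ j` to the multilinear fractional integral. -/
noncomputable def scaledProd {n m : ℕ} (α : ℝ) (g : Fin m → EuclideanSpace ℝ (Fin n) → ℝ≥0∞) (j : ℤ)
    (x : EuclideanSpace ℝ (Fin n)) : ℝ≥0∞ :=
  (4 : ℝ≥0∞) ^ ((j : ℝ) * (α - m * n)) * ballProd g j x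

theorem measurable_scaledProd {n m : ℕ} (α : ℝ) {g : Fin m → EuclideanSpace ℝ (Fin n) → ℝ≥0∞}
    (hg : ∀ i, Measurable (g i)) (j : ℤ) : Measurable (scaledProd α g j) :=
  (measurable_ballProd hg _).const_mul _

/-- Goodness compares averages without decay; the additional factor `4 ^ (j * α)` in `scaledProd`
supplies the decay in `j - i` when `α` is positive. -/
theorem scaledProd_le_of_mem_goodSet {n m : ℕ} (α : ℝ)
    {g : Fin m → EuclideanSpace ℝ (Fin n) → ℝ≥0∞} {B : ℝ≥0∞} {i j : ℤ} (hij : i ≤ j)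
    {y : EuclideanSpace ℝ (Fin n)} (hy : y ∈ goodSet g B j) :
    scaledProd α g i y ≤ B * ((4 : ℝ≥0∞) ^ (((i : ℝ) - j) * α) * scaledProd α g j y) := by
  unfold scaledProd
  calc _ ≤ (4 : ℝ≥0∞) ^ ((i : ℝ) * (α - m * n)) *
        (B * ((4 : ℝ≥0∞) ^ (((i : ℝ) - j) * (m * n)) * ballProd g j y)) := by
        gcongr
        exact hy i hij
    _ = B * ((4 : ℝ≥0∞) ^ ((i : ℝ) * (α - m * n) + ((i : ℝ) - j) * (m * n)) * ballProd g j y) := by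
        rw [four_rpow_add]
        ring
    _ = _ := by
        rw [← mul_assoc (4 ^ (((i : ℝ) - j) * α)), ← four_rpow_add]
        congr 3
        ring

/-- At every point, the scales at which the point is good contribute a geometric sum. -/
theorem tsum_indicator_goodSet_le {n m : ℕ} {α p : ℝ} (hp : 0 < p)
    (g : Fin m → EuclideanSpace ℝ (Fin n) → ℝ≥0∞) (B : ℝ≥0∞) (y : EuclideanSpace ℝ (Fin n)) :
    ∑' j : ℤ, (goodSet g B j).indicator (fun y => scaledProd α g j y ^ p) y
      ≤ B ^ p * (∑' k : ℕ, ((4 : ℝ≥0∞) ^ (-(α * p))) ^ k) * (⨆ j : ℤ, scaledProd α g j y) ^ p := by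
  classical
  -- The good scales of `y` may have no largest element, so finite partial sums are bounded
  -- uniformly.
  rw [ENNReal.tsum_eq_iSup_sum]
  refine iSup_le fun F => ?_
  simp only [Set.indicator_apply]
  rw [← Finset.sum_filter]
  set F' := F.filter fun j => y ∈ goodSet g B j with hF'
  rcases F'.eq_empty_or_nonempty with he | hne
  · simp [he]
  set J := F'.max' hne with hJ
  have hJgood : y ∈ goodSet g B J := (Finset.mem_filter.1 (F'.max'_mem hne)).2
  have hle : ∀ i ∈ F', i ≤ J := fun i hi => F'.le_max' i hi
  calc ∑ i ∈ F', scaledProd α g i y ^ p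
      ≤ ∑ i ∈ F', B ^ p * ((4 : ℝ≥0∞) ^ (-(α * p))) ^ (J - i).toNat *
          (⨆ j : ℤ, scaledProd α g j y) ^ p := by
        refine Finset.sum_le_sum fun i hi => ?_
        calc scaledProd α g i y ^ p
            ≤ (B * ((4 : ℝ≥0∞) ^ (((i : ℝ) - J) * α) * ⨆ j : ℤ, scaledProd α g j y)) ^ p := by
              gcongr
              refine (scaledProd_le_of_mem_goodSet α (hle i hi) hJgood).trans ?_
              gcongr
              exact le_iSup (fun j : ℤ => scaledProd α g j y) J
          _ = _ := by
              rw [ENNReal.mul_rpow_of_nonneg _ _ hp.le, ENNReal.mul_rpow_of_nonneg _ _ hp.le,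
                ← ENNReal.rpow_mul, ← ENNReal.rpow_mul_natCast, mul_assoc (B ^ p)]
              congr 3
              have h1 : (((J - i).toNat : ℤ) : ℝ) = ((J - i : ℤ) : ℝ) := by
                rw [Int.toNat_of_nonneg (by have := hle i hi; omega)]
              rw [Int.cast_natCast, Int.cast_sub] at h1
              rw [h1]
              ring
    _ = B ^ p * (∑ i ∈ F', ((4 : ℝ≥0∞) ^ (-(α * p))) ^ (J - i).toNat) *
          (⨆ j : ℤ, scaledProd α g j y) ^ p := by
        rw [← Finset.sum_mul, ← Finset.mul_sum]
    _ ≤ _ := by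
        gcongr
        -- The gaps `J - i` are distinct, so the finite sum is part of the full geometric series.
        have hinj : Set.InjOn (fun i : ℤ => (J - i).toNat) F' := by
          intro a ha b hb hab
          have h1 := hle a ha
          have h2 := hle b hb
          simp only at hab
          omega
        rw [← Finset.sum_image (f := fun k : ℕ => ((4 : ℝ≥0∞) ^ (-(α * p))) ^ k) hinj]
        exact ENNReal.sum_le_tsum _

theorem tsum_geometric_four_rpow_ne_top {s : ℝ} (hs : 0 < s) :
    ∑' k : ℕ, ((4 : ℝ≥0∞) ^ (-s)) ^ k ≠ ∞ := by
  rw [ENNReal.tsum_geometric]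
  refine ENNReal.inv_ne_top.2 (tsub_pos_of_lt ?_).ne'
  exact ENNReal.rpow_lt_one_of_one_lt_of_neg (by norm_num) (by linarith)

/-- The ball of radius `4 ^ j` is enclosed in a cube of side `2 * 4 ^ j`; the factor 2 in the side,
raised to the homogeneity `α - m * n`, gives the constant. -/
theorem scaledProd_le_fracMaximal {n m : ℕ} (hn : n ≠ 0) {α : ℝ}
    {f : Fin m → EuclideanSpace ℝ (Fin n) → ℂ} {g : Fin m → EuclideanSpace ℝ (Fin n) → ℝ≥0∞}
    (hgf : ∀ i, (fun x => ‖f i x‖ₑ) =ᵐ[volume] g i) (j : ℤ) (x : EuclideanSpace ℝ (Fin n)) :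
    scaledProd α g j x ≤ (2 : ℝ≥0∞) ^ ((m : ℝ) * n - α) * fracMaximal α f x := by
  obtain ⟨Q, hQ, hxQ, hsub, hvol⟩ := exists_cube_closedBall_subset x
    (show (0 : ℝ) < (4 : ℝ) ^ (j : ℝ) by positivity)
  rw [ENNReal.ofReal_mul (by norm_num), ofReal_four_rpow, ENNReal.ofReal_ofNat] at hvol
  have hint : ∀ i, ∫⁻ y in Metric.closedBall x ((4 : ℝ) ^ (j : ℝ)), g i y
      ≤ ∫⁻ y in Q, ‖f i y‖ₑ := fun i => by
    rw [← lintegral_congr_ae (ae_restrict_of_ae (hgf i))]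
    exact lintegral_mono_set hsub
  set W : ℝ≥0∞ := 2 * 4 ^ (j : ℝ) with hW
  have hW0 : W ≠ 0 := mul_ne_zero (by norm_num) (four_rpow_ne_zero _)
  have hWt : W ≠ ∞ := ENNReal.mul_ne_top (by norm_num) (four_rpow_ne_top _)
  have hpow : (W ^ n) ^ (α / n) * ((W ^ n)⁻¹) ^ m
      = (2 : ℝ≥0∞) ^ (α - m * n) * (4 : ℝ≥0∞) ^ ((j : ℝ) * (α - m * n)) := by
    have hn' : (n : ℝ) ≠ 0 := by exact_mod_cast hn
    rw [ENNReal.rpow_mul, ← ENNReal.mul_rpow_of_ne_top (by norm_num) (four_rpow_ne_top _), ← hW,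
      ← ENNReal.rpow_natCast, ← ENNReal.rpow_mul, ← ENNReal.rpow_neg, ← ENNReal.rpow_mul_natCast,
      ← ENNReal.rpow_add _ _ hW0 hWt]
    congr 1
    field_simp
    ring
  have hmax : volume Q ^ (α / (n : ℝ)) * ∏ i, ((volume Q)⁻¹ * ∫⁻ y in Q, ‖f i y‖ₑ)
      ≤ fracMaximal α f x :=
    le_iSup_of_le Q (le_iSup_of_le hQ (le_iSup_of_le hxQ le_rfl))
  have hle : (2 : ℝ≥0∞) ^ (α - m * n) * scaledProd α g j x ≤ fracMaximal α f x := by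
    refine le_trans ?_ hmax
    rw [hvol, Finset.prod_mul_distrib, Finset.prod_const, Finset.card_univ, Fintype.card_fin,
      ← mul_assoc, hpow, scaledProd, ← mul_assoc]
    gcongr
    exact Finset.prod_le_prod' fun i _ => hint i
  calc scaledProd α g j x
      = (2 : ℝ≥0∞) ^ ((m : ℝ) * n - α) * ((2 : ℝ≥0∞) ^ (α - m * n) * scaledProd α g j x) := by
        rw [← mul_assoc, ← ENNReal.rpow_add _ _ (by norm_num) (by norm_num)]
        simp
    _ ≤ _ := by gcongr

theorem lintegral_closedBall_le_hlMaximal {n : ℕ} (u : EuclideanSpace ℝ (Fin n) → ℝ≥0∞) (j : ℤ)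
    (y : EuclideanSpace ℝ (Fin n)) :
    (((4 : ℝ≥0∞) ^ (j : ℝ)) ^ n)⁻¹ * ∫⁻ x in Metric.closedBall y ((4 : ℝ) ^ (j : ℝ)), u x
      ≤ 2 ^ n * hlMaximal u y := by
  obtain ⟨Q, hQ, hxQ, hsub, hvol⟩ := exists_cube_closedBall_subset y
    (show (0 : ℝ) < (4 : ℝ) ^ (j : ℝ) by positivity)
  rw [ENNReal.ofReal_mul (by norm_num), ofReal_four_rpow, ENNReal.ofReal_ofNat, mul_pow] at hvol
  have hmax : (volume Q)⁻¹ * ∫⁻ x in Q, u x ≤ hlMaximal u y :=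
    le_iSup_of_le Q (le_iSup_of_le hQ (le_iSup_of_le hxQ le_rfl))
  rw [hvol, ENNReal.mul_inv (.inl (by positivity)) (.inl (by finiteness))] at hmax
  calc _ = 2 ^ n * ((2 ^ n)⁻¹ * (((4 : ℝ≥0∞) ^ (j : ℝ)) ^ n)⁻¹ *
        ∫⁻ x in Metric.closedBall y ((4 : ℝ) ^ (j : ℝ)), u x) := by
        rw [← mul_assoc, ← mul_assoc, ENNReal.mul_inv_cancel (by positivity) (by finiteness),
          one_mul]
    _ ≤ _ := by
        gcongr
        refine le_trans ?_ hmax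
        gcongr

/-- Rescaled form of `lintegral_ballProd_mul_le`: `4 ^ ((m * n - α) * p)` is the cost of passing
from scale `j` to `j + 1`, and the volume factor is moved next to the integral of `u` to form an
average. -/
theorem lintegral_scaledProd_le {n m : ℕ} {α p : ℝ} (hp : 0 < p)
    {g : Fin m → EuclideanSpace ℝ (Fin n) → ℝ≥0∞} (hg : ∀ i, Measurable (g i))
    {u : EuclideanSpace ℝ (Fin n) → ℝ≥0∞} (hu : Measurable u) (j : ℤ) :
    ∫⁻ x, scaledProd α g j x ^ p * u x
      ≤ 2 * (volume (Metric.ball (0 : EuclideanSpace ℝ (Fin n)) 1))⁻¹ *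
          (4 : ℝ≥0∞) ^ (((m : ℝ) * n - α) * p) *
        ∫⁻ y, (goodSet g (goodConst n m) (j + 1)).indicator
          (fun y => scaledProd α g (j + 1) y ^ p) y *
            ((((4 : ℝ≥0∞) ^ (j : ℝ)) ^ n)⁻¹ *
              ∫⁻ x in Metric.closedBall y ((4 : ℝ) ^ (j : ℝ)), u x) := by
  have h := lintegral_ballProd_mul_le hg hu hp j
  set ω := volume (Metric.ball (0 : EuclideanSpace ℝ (Fin n)) 1) with hω
  have hω0 : ω ≠ 0 := (Metric.measure_ball_pos _ _ one_pos).ne'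
  have hωt : ω ≠ ∞ := measure_ball_lt_top.ne
  set c := ((4 : ℝ≥0∞) ^ (j : ℝ)) ^ n with hc
  have hc0 : c ≠ 0 := pow_ne_zero _ (four_rpow_ne_zero _)
  have hct : c ≠ ∞ := ENNReal.pow_ne_top (four_rpow_ne_top _)
  set G := goodSet g (goodConst n m) (j + 1) with hG
  have hUm := measurable_setLIntegral_closedBall hu ((4 : ℝ) ^ (j : ℝ))
  have hHm : Measurable (G.indicator fun y => ballProd g ((j + 1 : ℤ) : ℝ) y ^ p) :=
    ((measurable_ballProd hg _).pow_const p).indicator (measurableSet_goodSet hg _ _)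
  have hl : ∫⁻ x, scaledProd α g j x ^ p * u x
      = (4 : ℝ≥0∞) ^ ((j : ℝ) * (α - m * n) * p) * ∫⁻ x, ballProd g j x ^ p * u x := by
    rw [← lintegral_const_mul (f := fun x => ballProd g j x ^ p * u x) _
      (((measurable_ballProd hg _).pow_const p).mul hu)]
    refine lintegral_congr fun x => ?_
    rw [scaledProd, ENNReal.mul_rpow_of_nonneg _ _ hp.le, ← ENNReal.rpow_mul, mul_assoc]
  have hr : ∫⁻ y, G.indicator (fun y => scaledProd α g (j + 1) y ^ p) y *
            (c⁻¹ * ∫⁻ x in Metric.closedBall y ((4 : ℝ) ^ (j : ℝ)), u x)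
      = (4 : ℝ≥0∞) ^ (((j + 1 : ℤ) : ℝ) * (α - m * n) * p) * c⁻¹ *
        ∫⁻ y, G.indicator (fun y => ballProd g ((j + 1 : ℤ) : ℝ) y ^ p) y *
          ∫⁻ x in Metric.closedBall y ((4 : ℝ) ^ (j : ℝ)), u x := by
    rw [← lintegral_const_mul (f := fun y => G.indicator
      (fun y => ballProd g ((j + 1 : ℤ) : ℝ) y ^ p) y *
        ∫⁻ x in Metric.closedBall y ((4 : ℝ) ^ (j : ℝ)), u x) _ (hHm.mul hUm)]
    refine lintegral_congr fun y => ?_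
    by_cases hy : y ∈ G
    · simp only [Set.indicator_of_mem hy]
      rw [scaledProd, ENNReal.mul_rpow_of_nonneg _ _ hp.le, ← ENNReal.rpow_mul]
      ring
    · simp [Set.indicator_of_notMem hy]
  rw [hl, hr]
  set I := ∫⁻ x, ballProd g j x ^ p * u x
  set I' := ∫⁻ y, G.indicator (fun y => ballProd g ((j + 1 : ℤ) : ℝ) y ^ p) y *
          ∫⁻ x in Metric.closedBall y ((4 : ℝ) ^ (j : ℝ)), u x
  have e : (4 : ℝ≥0∞) ^ ((j : ℝ) * (α - m * n) * p) = (4 : ℝ≥0∞) ^ (((m : ℝ) * n - α) * p) *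
      (4 : ℝ≥0∞) ^ (((j + 1 : ℤ) : ℝ) * (α - m * n) * p) := by
    rw [← four_rpow_add]
    congr 1
    push_cast
    ring
  rw [e]
  set a := (4 : ℝ≥0∞) ^ (((m : ℝ) * n - α) * p)
  set b := (4 : ℝ≥0∞) ^ (((j + 1 : ℤ) : ℝ) * (α - m * n) * p)
  calc a * b * I = a * b * (c⁻¹ * c) * (ω⁻¹ * ω) * I := by
        rw [ENNReal.inv_mul_cancel hc0 hct, ENNReal.inv_mul_cancel hω0 hωt, mul_one, mul_one]
    _ = a * b * c⁻¹ * ω⁻¹ * (c * ω * I) := by ring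
    _ ≤ a * b * c⁻¹ * ω⁻¹ * (2 * I') := by gcongr
    _ = _ := by ring

/-- The inequality for the discretized operator. -/
theorem exists_tsum_lintegral_scaledProd_le (n m : ℕ) (hn : n ≠ 0) {α p : ℝ} (hα : 0 < α)
    (hp : 0 < p) :
    ∃ C : ℝ≥0∞, C ≠ ∞ ∧ ∀ (f : Fin m → EuclideanSpace ℝ (Fin n) → ℂ)
      (g : Fin m → EuclideanSpace ℝ (Fin n) → ℝ≥0∞) (u : EuclideanSpace ℝ (Fin n) → ℝ≥0∞),
      (∀ i, (fun x => ‖f i x‖ₑ) =ᵐ[volume] g i) → (∀ i, Measurable (g i)) → Measurable u →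
      ∑' j : ℤ, ∫⁻ x, scaledProd α g j x ^ p * u x
        ≤ C * ∫⁻ x, fracMaximal α f x ^ p * hlMaximal u x := by
  set ω := volume (Metric.ball (0 : EuclideanSpace ℝ (Fin n)) 1) with hω
  have hω0 : ω ≠ 0 := (Metric.measure_ball_pos _ _ one_pos).ne'
  set A := 2 * ω⁻¹ * (4 : ℝ≥0∞) ^ (((m : ℝ) * n - α) * p) with hA
  set K := goodConst n m ^ p * ∑' k : ℕ, ((4 : ℝ≥0∞) ^ (-(α * p))) ^ k with hK
  set D := (2 : ℝ≥0∞) ^ ((m : ℝ) * n - α) with hD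
  have hAt : A ≠ ∞ := ENNReal.mul_ne_top
    (ENNReal.mul_ne_top (by norm_num) (ENNReal.inv_ne_top.2 hω0)) (four_rpow_ne_top _)
  have hKt : K ≠ ∞ := ENNReal.mul_ne_top (ENNReal.rpow_ne_top_of_nonneg hp.le (goodConst_ne_top n m))
    (tsum_geometric_four_rpow_ne_top (by positivity))
  have hDt : D ^ p * 2 ^ n ≠ ∞ := by
    refine ENNReal.mul_ne_top (ENNReal.rpow_ne_top_of_nonneg hp.le ?_) (by finiteness)
    simp [hD, ENNReal.rpow_eq_top_iff]
  refine ⟨A * (K * (D ^ p * 2 ^ n)), ENNReal.mul_ne_top hAt (ENNReal.mul_ne_top hKt hDt), ?_⟩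
  intro f g u hgf hg hu
  set U : ℤ → EuclideanSpace ℝ (Fin n) → ℝ≥0∞ := fun j y => (((4 : ℝ≥0∞) ^ (j : ℝ)) ^ n)⁻¹ *
    ∫⁻ x in Metric.closedBall y ((4 : ℝ) ^ (j : ℝ)), u x with hU
  set H : ℤ → EuclideanSpace ℝ (Fin n) → ℝ≥0∞ := fun j =>
    (goodSet g (goodConst n m) j).indicator (fun y => scaledProd α g j y ^ p) with hH
  have hHm : ∀ j, Measurable (H j) := fun j =>
    ((measurable_scaledProd α hg j).pow_const p).indicator (measurableSet_goodSet hg _ _)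
  have hUm : ∀ j, Measurable (U j) := fun j =>
    (measurable_setLIntegral_closedBall hu _).const_mul _
  have hpt : ∀ y, ∑' j : ℤ, H (j + 1) y * U j y
      ≤ K * (D ^ p * 2 ^ n) * (fracMaximal α f y ^ p * hlMaximal u y) := by
    intro y
    calc ∑' j : ℤ, H (j + 1) y * U j y
        ≤ ∑' j : ℤ, H (j + 1) y * (2 ^ n * hlMaximal u y) := by
          refine ENNReal.tsum_le_tsum fun j => ?_
          gcongr
          exact lintegral_closedBall_le_hlMaximal u j y
      _ = (∑' j : ℤ, H j y) * (2 ^ n * hlMaximal u y) := by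
          -- Summing over all integers absorbs the shift from `j` to `j + 1`.
          rw [ENNReal.tsum_mul_right, ← (Equiv.addRight (1 : ℤ)).tsum_eq fun j => H j y]
          rfl
      _ ≤ K * (D * fracMaximal α f y) ^ p * (2 ^ n * hlMaximal u y) := by
          gcongr
          refine (tsum_indicator_goodSet_le hp g _ y).trans ?_
          gcongr
          exact iSup_le fun j => scaledProd_le_fracMaximal hn hgf j y
      _ = _ := by
          rw [ENNReal.mul_rpow_of_nonneg _ _ hp.le]
          ring
  calc ∑' j : ℤ, ∫⁻ x, scaledProd α g j x ^ p * u x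
      ≤ ∑' j : ℤ, A * ∫⁻ y, H (j + 1) y * U j y :=
        ENNReal.tsum_le_tsum fun j => lintegral_scaledProd_le hp hg hu j
    _ = A * ∫⁻ y, ∑' j : ℤ, H (j + 1) y * U j y := by
        rw [ENNReal.tsum_mul_left, lintegral_tsum (f := fun j y => H (j + 1) y * U j y)
          fun j => ((hHm _).mul (hUm _)).aemeasurable]
    _ ≤ A * ∫⁻ y, K * (D ^ p * 2 ^ n) * (fracMaximal α f y ^ p * hlMaximal u y) := by
        gcongr with y
        exact hpt y
    _ = _ := by
        rw [lintegral_const_mul' _ _ (ENNReal.mul_ne_top hKt hDt)]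
        ring

/-! ### Domination of the fractional integral by the sum over scales -/

/-- If `4 ^ j < ∑ i, ‖x - y i‖ ≤ 4 ^ (j + 1)`, every `y i` lies in the ball of radius `4 ^ (j + 1)`,
so the single term `j + 1` dominates. The constant comes from using the lower bound `4 ^ j` in the
denominator. -/
theorem enorm_fracIntegrand_le {n m : ℕ} {α : ℝ} (hα : α < (n : ℝ) * m)
    (f : Fin m → EuclideanSpace ℝ (Fin n) → ℂ) (x : EuclideanSpace ℝ (Fin n))
    (y : Fin m → EuclideanSpace ℝ (Fin n)) :
    ‖fracIntegrand α f x y‖ₑ ≤ (4 : ℝ≥0∞) ^ ((m : ℝ) * n - α) *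
      ∑' j : ℤ, (4 : ℝ≥0∞) ^ ((j : ℝ) * (α - m * n)) *
        ∏ i, (Metric.closedBall x ((4 : ℝ) ^ (j : ℝ))).indicator (fun z => ‖f i z‖ₑ) (y i) := by
  have hd : 0 < (m : ℝ) * n - α := by linarith [mul_comm (n : ℝ) m]
  set s := ∑ i, ‖x - y i‖ with hs
  have hs0 : 0 ≤ s := Finset.sum_nonneg fun i _ => norm_nonneg _
  rcases hs0.eq_or_lt with h0 | hpos
  -- On the diagonal the denominator is 0, and division by zero makes the integrand 0.
  · simp [fracIntegrand, ← hs, ← h0, Real.zero_rpow hd.ne']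
  obtain ⟨j, hj1, hj2⟩ := exists_mem_Ioc_zpow hpos (show (1 : ℝ) < 4 by norm_num)
  rw [← Real.rpow_intCast] at hj1 hj2
  refine le_trans ?_ (mul_le_mul_right (ENNReal.le_tsum (j + 1)) _)
  have hmem : ∀ i, y i ∈ Metric.closedBall x ((4 : ℝ) ^ ((j + 1 : ℤ) : ℝ)) := fun i => by
    rw [Metric.mem_closedBall, dist_comm, dist_eq_norm]
    exact (Finset.single_le_sum (f := fun i => ‖x - y i‖) (fun i _ => norm_nonneg _)
      (Finset.mem_univ i)).trans hj2
  simp only [Set.indicator_of_mem (hmem _)]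
  have hlow : (4 : ℝ≥0∞) ^ ((j : ℝ) * ((m : ℝ) * n - α))
      ≤ ‖((s ^ ((m : ℝ) * n - α) : ℝ) : ℂ)‖ₑ := by
    rw [← ofReal_four_rpow, ← ofReal_norm, Complex.norm_real, Real.norm_eq_abs,
      abs_of_nonneg (by positivity)]
    refine ENNReal.ofReal_le_ofReal ?_
    rw [Real.rpow_mul (by norm_num)]
    exact Real.rpow_le_rpow (by positivity) hj1.le hd.le
  have hne : ((s ^ ((m : ℝ) * n - α) : ℝ) : ℂ) ≠ 0 := by
    exact_mod_cast (Real.rpow_pos_of_pos hpos _).ne'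
  calc ‖fracIntegrand α f x y‖ₑ
      = (‖((s ^ ((m : ℝ) * n - α) : ℝ) : ℂ)‖ₑ)⁻¹ * ∏ i, ‖f i (y i)‖ₑ := by
        rw [fracIntegrand, div_eq_mul_inv, enorm_mul, enorm_inv hne, mul_comm]
        congr 1
        simp [← ofReal_norm, norm_prod, ENNReal.ofReal_prod_of_nonneg]
    _ ≤ ((4 : ℝ≥0∞) ^ ((j : ℝ) * ((m : ℝ) * n - α)))⁻¹ * ∏ i, ‖f i (y i)‖ₑ := by gcongr
    _ = _ := by
        rw [← mul_assoc, ← four_rpow_add, ← ENNReal.rpow_neg]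
        congr 2
        push_cast
        ring

theorem lintegral_enorm_fracIntegrand_le {n m : ℕ} {α : ℝ} (hα : α < (n : ℝ) * m)
    {f : Fin m → EuclideanSpace ℝ (Fin n) → ℂ} {g : Fin m → EuclideanSpace ℝ (Fin n) → ℝ≥0∞}
    (hgf : ∀ i, (fun x => ‖f i x‖ₑ) =ᵐ[volume] g i) (hg : ∀ i, Measurable (g i))
    (x : EuclideanSpace ℝ (Fin n)) :
    ∫⁻ y, ‖fracIntegrand α f x y‖ₑ
      ≤ (4 : ℝ≥0∞) ^ ((m : ℝ) * n - α) * ∑' j : ℤ, scaledProd α g j x := by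
  have hae : ∀ᵐ y : Fin m → EuclideanSpace ℝ (Fin n), ∀ i, ‖f i (y i)‖ₑ = g i (y i) :=
    ae_all_iff.2 fun i =>
      (Measure.quasiMeasurePreserving_eval (fun _ : Fin m => volume) i).ae
        (show ∀ᵐ z, ‖f i z‖ₑ = g i z from hgf i)
  have him : ∀ (j : ℤ) (i : Fin m),
      Measurable ((Metric.closedBall x ((4 : ℝ) ^ (j : ℝ))).indicator (g i)) := fun j i =>
    (hg i).indicator Metric.isClosed_closedBall.measurableSet
  have hpm : ∀ j : ℤ, Measurable fun y : Fin m → EuclideanSpace ℝ (Fin n) =>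
      ∏ i, (Metric.closedBall x ((4 : ℝ) ^ (j : ℝ))).indicator (g i) (y i) := fun j =>
    Finset.measurable_prod _ fun i _ => (him j i).comp (measurable_pi_apply i)
  calc ∫⁻ y, ‖fracIntegrand α f x y‖ₑ
      ≤ ∫⁻ y : Fin m → EuclideanSpace ℝ (Fin n), (4 : ℝ≥0∞) ^ ((m : ℝ) * n - α) *
        ∑' j : ℤ, (4 : ℝ≥0∞) ^ ((j : ℝ) * (α - m * n)) *
          ∏ i, (Metric.closedBall x ((4 : ℝ) ^ (j : ℝ))).indicator (g i) (y i) := by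
        refine lintegral_mono_ae ?_
        filter_upwards [hae] with y hy
        have key : ∀ (j : ℤ) (i : Fin m), (Metric.closedBall x ((4 : ℝ) ^ (j : ℝ))).indicator
            (fun z => ‖f i z‖ₑ) (y i)
              = (Metric.closedBall x ((4 : ℝ) ^ (j : ℝ))).indicator (g i) (y i) := fun j i => by
          classical
          rw [Set.indicator_apply, Set.indicator_apply, hy]
        simpa only [key] using enorm_fracIntegrand_le hα f x y
    _ = _ := by
        rw [lintegral_const_mul' _ _ (four_rpow_ne_top _),
          lintegral_tsum fun j => ((hpm j).const_mul _).aemeasurable]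
        congr 2
        ext j
        rw [lintegral_const_mul' _ _ (four_rpow_ne_top _), volume_pi,
          lintegral_pi_prod volume _ (him j), scaledProd, ballProd]
        congr 2
        ext i
        rw [lintegral_indicator Metric.isClosed_closedBall.measurableSet]

/-! ### Measurable representatives and the main theorem -/

theorem hlMaximal_congr_ae {n : ℕ} {u v : EuclideanSpace ℝ (Fin n) → ℝ≥0∞}
    (h : u =ᵐ[volume] v) : hlMaximal u = hlMaximal v := by
  ext x
  unfold hlMaximal
  have hQ : ∀ Q : Set (EuclideanSpace ℝ (Fin n)), ∫⁻ y in Q, u y = ∫⁻ y in Q, v y := fun Q =>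
    lintegral_congr_ae (ae_restrict_of_ae h)
  simp only [hQ]

theorem aestronglyMeasurable_fracIntegrand {n m : ℕ} (α : ℝ)
    {f : Fin m → EuclideanSpace ℝ (Fin n) → ℂ} (hf : ∀ i, AEMeasurable (f i))
    (x : EuclideanSpace ℝ (Fin n)) : AEStronglyMeasurable (fracIntegrand α f x) := by
  refine AEMeasurable.aestronglyMeasurable (AEMeasurable.div ?_ ?_)
  · exact Finset.aemeasurable_fun_prod _ fun i _ => (hf i).comp_quasiMeasurePreserving
      (Measure.quasiMeasurePreserving_eval (fun _ : Fin m => volume) i)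
  · refine (Complex.measurable_ofReal.comp (Measurable.pow_const ?_ _)).aemeasurable
    exact Finset.measurable_sum _ fun i _ => (measurable_const.sub (measurable_pi_apply i)).norm

theorem mainTheorem6 (n m : ℕ) (α p : ℝ) (hα : 0 < α) (hα' : α < (n : ℝ) * m)
    (hp : 0 < p) (hp' : p ≤ 1) :
    ∃ C : ℝ≥0, ∀ (f : Fin m → EuclideanSpace ℝ (Fin n) → ℂ)
      (u : EuclideanSpace ℝ (Fin n) → ℝ≥0∞),
      (∀ i, AEMeasurable (f i)) → AEMeasurable u →
        -- the integral inequality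
        ((∫⁻ x, ‖fracIntegral α f x‖ₑ ^ p * u x)
            ≤ C * ∫⁻ x, fracMaximal α f x ^ p * hlMaximal u x) ∧
        -- if the right-hand side is finite, the integral defining the fractional integral
        -- converges absolutely at almost every point where the weight does not vanish
        ((∫⁻ x, fracMaximal α f x ^ p * hlMaximal u x) < ∞ →
          ∀ᵐ x : EuclideanSpace ℝ (Fin n), u x ≠ 0 → Integrable (fracIntegrand α f x)) := by
  have hn : n ≠ 0 := by
    rintro rfl
    simp only [Nat.cast_zero, zero_mul] at hα'
    linarith
  obtain ⟨C, hC, hmain⟩ := exists_tsum_lintegral_scaledProd_le n m hn hα hp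
  set E := (4 : ℝ≥0∞) ^ ((m : ℝ) * n - α) with hE
  have hEt : E ≠ ∞ := four_rpow_ne_top _
  have hEp : E ^ p ≠ ∞ := ENNReal.rpow_ne_top_of_nonneg hp.le hEt
  refine ⟨(E ^ p * C).toNNReal, fun f u hf hu => ?_⟩
  rw [ENNReal.coe_toNNReal (ENNReal.mul_ne_top hEp hC)]
  -- Fubini is applied to Borel representatives; both maximal functions depend only on almost
  -- everywhere classes.
  set g : Fin m → EuclideanSpace ℝ (Fin n) → ℝ≥0∞ := fun i => (hf i).enorm.mk _ with hg
  have hgm : ∀ i, Measurable (g i) := fun i => (hf i).enorm.measurable_mk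
  have hgf : ∀ i, (fun x => ‖f i x‖ₑ) =ᵐ[volume] g i := fun i => (hf i).enorm.ae_eq_mk
  set v := hu.mk u with hv
  have hvm : Measurable v := hu.measurable_mk
  have huv : u =ᵐ[volume] v := hu.ae_eq_mk
  have hb := hmain f g v hgf hgm hvm
  rw [← hlMaximal_congr_ae huv] at hb
  have hI := lintegral_enorm_fracIntegrand_le hα' hgf hgm
  have hSm : ∀ j : ℤ, Measurable fun x => scaledProd α g j x ^ p * v x := fun j =>
    ((measurable_scaledProd α hgm j).pow_const p).mul hvm
  rw [← lintegral_tsum fun j => (hSm j).aemeasurable] at hb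
  constructor
  · calc ∫⁻ x, ‖fracIntegral α f x‖ₑ ^ p * u x
        ≤ ∫⁻ x, E ^ p * ∑' j : ℤ, scaledProd α g j x ^ p * v x := by
          refine lintegral_mono_ae ?_
          filter_upwards [huv] with x hx
          rw [hx, ENNReal.tsum_mul_right, ← mul_assoc]
          gcongr
          calc ‖fracIntegral α f x‖ₑ ^ p ≤ (E * ∑' j : ℤ, scaledProd α g j x) ^ p := by
                gcongr
                exact (enorm_integral_le_lintegral_enorm _).trans (hI x)
            _ = E ^ p * (∑' j : ℤ, scaledProd α g j x) ^ p := ENNReal.mul_rpow_of_nonneg _ _ hp.le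
            _ ≤ _ := by
                gcongr
                exact ENNReal.rpow_tsum_le hp hp' _
      _ = E ^ p * ∫⁻ x, ∑' j : ℤ, scaledProd α g j x ^ p * v x := lintegral_const_mul' _ _ hEp
      _ ≤ _ := by
          rw [mul_assoc]
          gcongr
  · intro hfin
    have hfin' := hb.trans_lt (ENNReal.mul_lt_top hC.lt_top hfin)
    filter_upwards [huv, ae_lt_top (Measurable.tsum hSm) hfin'.ne] with x hx hlt hux
    refine ⟨aestronglyMeasurable_fracIntegrand α hf x, (hI x).trans_lt ?_⟩
    -- Where the weight is nonzero it can be removed from the finite product, leaving a finite sum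
    -- of `p`-th powers. Since `p ≤ 1`, the sum itself is then finite and dominates the integral of
    -- the absolute value.
    rw [ENNReal.tsum_mul_right] at hlt
    have h1 : ∑' j : ℤ, scaledProd α g j x ^ p < ∞ :=
      ENNReal.lt_top_of_mul_ne_top_left hlt.ne (hx ▸ hux)
    have h2 := (ENNReal.rpow_tsum_le hp hp' fun j : ℤ => scaledProd α g j x).trans_lt h1
    exact ENNReal.mul_lt_top hEt.lt_top ((ENNReal.rpow_lt_top_iff_of_pos hp).1 h2)
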